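/- For every integer $n\ge 0$ let $$b_n=\sum_{k=0}^{n}\frac{\binom{n}{k}\binom{n+k}{k}}{2k-1}.$$ Then the sequence $\{a_n\}_{n\ge 0}$ with $a_n=b_n/n!$ satisfies the higher order Turán inequality, that is, for all integers $n\ge 1$, $$4\,(a_n^2-a_{n-1}a_{n+1})(a_{n+1}^2-a_na_{n+2})-(a_na_{n+1}-a_{n-1}a_{n+2})^2\ \ge\ 0 .$$ -/

import Mathlib

/-- A real sequence `(a_n)_{n ≥ 0}` satisfies the higher order Turán inequalities if
`4 (a_n² - a_{n-1} a_{n+1}) (a_{n+1}² - a_n a_{n+2}) - (a_n a_{n+1} - a_{n-1} a_{n+2})² ≥ 0`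
for all `n ≥ 1`. (The index `n - 1` is never truncated, since `1 ≤ n`.) -/
def HigherOrderTuran (a : ℕ → ℝ) : Prop :=
  ∀ n : ℕ, 1 ≤ n →
    4 * (a n ^ 2 - a (n - 1) * a (n + 1)) * (a (n + 1) ^ 2 - a n * a (n + 2))
      - (a n * a (n + 1) - a (n - 1) * a (n + 2)) ^ 2 ≥ 0

/-- `b_n = ∑_{k=0}^{n} C(n,k) C(n+k,k) / (2k - 1)`, with the division taken in `ℝ`;
the term `k = 0` is `-1`. -/
noncomputable def seqB (n : ℕ) : ℝ :=
  ∑ k ∈ Finset.range (n + 1),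
    ((n.choose k : ℝ) * ((n + k).choose k : ℝ)) / (2 * (k : ℝ) - 1)

/-! Creative telescoping gives a third-order recurrence for `seqB`, with limiting characteristic
polynomial `(x - 1) (x² - 6x + 1)`. Put `e = growthInv`, a root of `x² - 6x + 1`, and `N = n + 1`.
From index 9 on, induction traps `e * seqB (n + 1) / seqB n` between `1 - 3/(2N) - 1/N²` and `1 -
3/(2N)` (`seqBRatioBounds`). Consecutive ratios then bound `a_n a_{n+2} / a_{n+1}²` between
`(n+1)/(n+2)` and `(n+6)/(n+7)`. If `s`, `r` are the reciprocals of two successive relative defects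
`1 - a_n a_{n+2} / a_{n+1}²`, the claim becomes `(s + r - 1)² ≤ 4sr`, true since `s` and `r` are
large and close together. -/

/-! ### Recurrence by creative telescoping, and initial values. -/

/-- The product `C(n,k) C(n+k,k)`, as a real number. -/
noncomputable def delannoyTerm (n k : ℕ) : ℝ := (n.choose k : ℝ) * ((n + k).choose k : ℝ)

lemma delannoyTerm_eq_zero {n k : ℕ} (h : n < k) : delannoyTerm n k = 0 := by
  simp [delannoyTerm, Nat.choose_eq_zero_of_lt h]

lemma delannoyTerm_succ_left (n k : ℕ) :
    (n + 1 + k : ℝ) * delannoyTerm n k = (n + 1 - k : ℝ) * delannoyTerm (n + 1) k := by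
  rcases Nat.lt_or_ge n k with h | h
  · rw [delannoyTerm_eq_zero h]
    rcases Nat.lt_or_ge (n + 1) k with h' | h'
    · rw [delannoyTerm_eq_zero h']; ring
    · obtain rfl : k = n + 1 := by omega
      push_cast; ring
  · have h1 : ((n + 1).choose k : ℝ) * (n + 1 - k) = (n + 1) * n.choose k := by
      have := Nat.choose_mul_succ_eq n k
      have hc : ((n + 1 - k : ℕ) : ℝ) = n + 1 - k := by
        rw [Nat.cast_sub (by omega)]; push_cast; ring
      rw [← hc]
      exact_mod_cast (this.symm.trans (mul_comm _ _))
    have h2 : ((n + 1 + k).choose k : ℝ) * (n + 1) = (n + 1 + k) * (n + k).choose k := by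
      have := Nat.choose_mul_succ_eq (n + k) k
      have hs : n + k + 1 - k = n + 1 := by omega
      rw [hs, show n + k + 1 = n + 1 + k by ring] at this
      have h3 : (((n + k).choose k * (n + 1 + k) : ℕ) : ℝ)
        = (((n + 1 + k).choose k * (n + 1) : ℕ) : ℝ) := by rw [this]
      push_cast at h3
      linarith
    have hn : (n + 1 : ℝ) ≠ 0 := by positivity
    unfold delannoyTerm
    apply mul_left_cancel₀ hn
    linear_combination (-((n + 1 + k).choose k : ℝ) * (n + 1)) * h1 -
      ((n + 1) * n.choose k : ℝ) * h2

lemma delannoyTerm_succ_right (n k : ℕ) :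
    (k + 1 : ℝ) ^ 2 * delannoyTerm n (k + 1) = (n - k) * (n + k + 1) * delannoyTerm n k := by
  have h1 : (n.choose (k + 1) : ℝ) * (k + 1) = n.choose k * (n - k) := by
    rcases Nat.lt_or_ge n k with h | h
    · simp [Nat.choose_eq_zero_of_lt h, Nat.choose_eq_zero_of_lt (Nat.lt_succ_of_lt h)]
    · have := Nat.choose_succ_right_eq n k
      rw [← Nat.cast_sub h]
      exact_mod_cast this
  have h2 : ((n + (k + 1)).choose (k + 1) : ℝ) * (k + 1) = (n + k + 1) * (n + k).choose k := by
    have := Nat.add_one_mul_choose_eq (n + k) k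
    exact_mod_cast this.symm
  unfold delannoyTerm
  linear_combination ((n + (k + 1)).choose (k + 1) : ℝ) * (k + 1) * h1 +
      ((n - k) * n.choose k : ℝ) * h2

lemma seqB_eq_sum_of_lt {n N : ℕ} (h : n < N) :
    seqB n = ∑ k ∈ Finset.range N, delannoyTerm n k / (2 * (k : ℝ) - 1) := by
  unfold seqB
  refine Finset.sum_subset (Finset.range_subset_range.2 h) fun k _ hk => ?_
  have : n < k := by simpa using hk
  change delannoyTerm n k / _ = 0
  rw [delannoyTerm_eq_zero this, zero_div]

/-- The antidifference certifying the recurrence of `seqB`. -/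
noncomputable def seqBCertificate (n k : ℕ) : ℝ :=
  -4 * (n + 2) * k ^ 2 * delannoyTerm (n + 3) k / ((n + k + 1) * (n + k + 2) * (n + k + 3))

lemma seqBCertificate_sub (n k : ℕ) :
    seqBCertificate n (k + 1) - seqBCertificate n k =
      (n + 3) * (delannoyTerm (n + 3) k / (2 * (k : ℝ) - 1))
      - (7 * n + 13) * (delannoyTerm (n + 2) k / (2 * (k : ℝ) - 1))
      + (7 * n + 15) * (delannoyTerm (n + 1) k / (2 * (k : ℝ) - 1))
      - (n + 1) * (delannoyTerm n k / (2 * (k : ℝ) - 1)) := by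
  have h1 : (n + k + 1 : ℝ) ≠ 0 := by positivity
  have h2 : (n + k + 2 : ℝ) ≠ 0 := by positivity
  have h3 : (n + k + 3 : ℝ) ≠ 0 := by positivity
  have h4 : (n + k + 4 : ℝ) ≠ 0 := by positivity
  have hk1 : (k + 1 : ℝ) ≠ 0 := by positivity
  have hk : (2 * k - 1 : ℝ) ≠ 0 := by
    intro h
    have : (2 * k : ℝ) = 1 := by linarith
    have : 2 * k = 1 := by exact_mod_cast this
    omega
  have e2 := delannoyTerm_succ_left (n + 2) k
  have e1 := delannoyTerm_succ_left (n + 1) k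
  have e0 := delannoyTerm_succ_left n k
  have er := delannoyTerm_succ_right (n + 3) k
  push_cast at e0 e1 e2 er
  simp only [show n + 2 + 1 = n + 3 from rfl, show n + 1 + 1 = n + 2 from rfl] at e0 e1 e2
  set T := delannoyTerm (n + 3) k
  -- Everything is expressed through the top index: descending divides by `n + k + i`, never zero,
  -- while ascending would divide by `n + i - k`.
  have f2 : delannoyTerm (n + 2) k = (n + 3 - k) * T / (n + k + 3) := by
    rw [eq_div_iff h3]; linear_combination e2
  have f1 : delannoyTerm (n + 1) k = (n + 2 - k) * ((n + 3 - k) * T) /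
      ((n + k + 2) * (n + k + 3)) := by
    rw [f2] at e1; field_simp at e1 ⊢; linear_combination e1
  have f0 : delannoyTerm n k = (n + 1 - k) * ((n + 2 - k) * ((n + 3 - k) * T)) /
      ((n + k + 1) * (n + k + 2) * (n + k + 3)) := by
    rw [f1] at e0; field_simp at e0 ⊢; linear_combination e0
  have fr : delannoyTerm (n + 3) (k + 1) = (n + 3 - k) * (n + k + 4) * T / (k + 1) ^ 2 := by
    rw [eq_div_iff (by positivity)]; linear_combination er
  unfold seqBCertificate
  rw [f2, f1, f0, fr]
  push_cast
  rw [show (n + (k + 1) + 1 : ℝ) = n + k + 2 by ring, show (n + (k + 1) + 2 : ℝ) = n + k + 3 by ring,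
    show (n + (k + 1) + 3 : ℝ) = n + k + 4 by ring]
  field_simp
  ring

lemma seqB_recurrence (n : ℕ) :
    (n + 3) * seqB (n + 3) =
      (7 * n + 13) * seqB (n + 2) - (7 * n + 15) * seqB (n + 1) + (n + 1) * seqB n := by
  -- The range `k < n + 4` covers the support of all four sums.
  have h := Finset.sum_range_sub (seqBCertificate n) (n + 4)
  simp only [seqBCertificate_sub] at h
  have h0 : seqBCertificate n 0 = 0 := by simp [seqBCertificate]
  have h1 : seqBCertificate n (n + 4) = 0 := by
    simp [seqBCertificate, delannoyTerm_eq_zero (show n + 3 < n + 4 by omega)]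
  rw [h0, h1, Finset.sum_sub_distrib, Finset.sum_add_distrib, Finset.sum_sub_distrib] at h
  simp only [← Finset.mul_sum] at h
  rw [← seqB_eq_sum_of_lt (by omega), ← seqB_eq_sum_of_lt (by omega),
    ← seqB_eq_sum_of_lt (by omega), ← seqB_eq_sum_of_lt (by omega)] at h
  linarith

lemma seqB_zero : seqB 0 = -1 := by norm_num [seqB]

lemma seqB_one : seqB 1 = 1 := by norm_num [seqB, Finset.sum_range_succ]

lemma seqB_two : seqB 2 = 7 := by norm_num [seqB, Finset.sum_range_succ, Nat.choose]

lemma seqB_three : seqB 3 = 25 := by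
  have h := seqB_recurrence 0
  norm_num [seqB_zero, seqB_one, seqB_two] at h; linarith

lemma seqB_four : seqB 4 = 87 := by
  have h := seqB_recurrence 1
  norm_num [seqB_one, seqB_two, seqB_three] at h; linarith

lemma seqB_five : seqB 5 = 329 := by
  have h := seqB_recurrence 2
  norm_num [seqB_two, seqB_three, seqB_four] at h; linarith

lemma seqB_six : seqB 6 = 1359 := by
  have h := seqB_recurrence 3
  norm_num [seqB_three, seqB_four, seqB_five] at h; linarith

lemma seqB_seven : seqB 7 = 6001 := by
  have h := seqB_recurrence 4
  norm_num [seqB_four, seqB_five, seqB_six] at h; linarith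

lemma seqB_eight : seqB 8 = 27759 := by
  have h := seqB_recurrence 5
  norm_num [seqB_five, seqB_six, seqB_seven] at h; linarith

lemma seqB_nine : seqB 9 = 132689 := by
  have h := seqB_recurrence 6
  norm_num [seqB_six, seqB_seven, seqB_eight] at h; linarith

lemma seqB_ten : seqB 10 = 649815 := by
  have h := seqB_recurrence 7
  norm_num [seqB_seven, seqB_eight, seqB_nine] at h; linarith

lemma seqB_eleven : seqB 11 = 3242377 := by
  have h := seqB_recurrence 8
  norm_num [seqB_eight, seqB_nine, seqB_ten] at h; linarith

/-! ### Two-sided bounds for consecutive ratios. -/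

/-- The inverse `3 - 2√2` of the exponential growth rate of `seqB`. -/
noncomputable def growthInv : ℝ := 3 - 2 * √2

lemma growthInv_sq : growthInv ^ 2 = 6 * growthInv - 1 := by
  have h : √2 ^ 2 = 2 := Real.sq_sqrt (by norm_num)
  unfold growthInv
  linear_combination 4 * h

lemma lt_growthInv : 0.171572 < growthInv := by
  have : √2 < 1.414214 := by rw [Real.sqrt_lt' (by norm_num)]; norm_num
  unfold growthInv; linarith

lemma growthInv_lt : growthInv < 0.171574 := by
  have : 1.414213 < √2 := by rw [Real.lt_sqrt (by norm_num)]; norm_num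
  unfold growthInv; linarith

/-- Bounds for `seqB (n + 1) / seqB n`, written without division. -/
structure SeqBRatioBounds (n : ℕ) : Prop where
  pos : 0 < seqB n
  upper : 2 * (n + 1) * growthInv * seqB (n + 1) ≤ (2 * n - 1) * seqB n
  lower : (2 * n + 3) * (n - 1) * seqB n ≤ 2 * (n + 1) ^ 2 * growthInv * seqB (n + 1)

/-- The lower ratio bound at `n` eliminates `x`. The net coefficient of `y` is then nonpositive
(`hK`), so the upper bound at `n + 1` eliminates `y`, leaving the polynomial inequality `hpoly`. -/
lemma ratio_upper_step {k e x y z w : ℝ} (hk : 9 ≤ k) (he : e ^ 2 = 6 * e - 1)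
    (hl : 0.171572 < e) (hu : e < 0.171574)
    (hz : 0 < z)
    (hrec : (k + 3) * w = (7 * k + 13) * z - (7 * k + 15) * y + (k + 1) * x)
    (hx : (2 * k + 3) * (k - 1) * x ≤ 2 * (k + 1) ^ 2 * e * y)
    (hy : 2 * (k + 2) * e * z ≤ (2 * k + 1) * y) :
    2 * (k + 3) * e * w ≤ (2 * k + 3) * z := by
  have he3 : e ^ 3 = 35 * e - 6 := by linear_combination (e + 6) * he
  have hQ : 0 < (2 * k + 3) * (k - 1) := mul_pos (by linarith) (by linarith)
  have hK : 0 ≤ 2 * e * ((7 * k + 15) * ((2 * k + 3) * (k - 1)) - 2 * e * (k + 1) ^ 3) := by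
    obtain ⟨m, rfl⟩ : ∃ m, k = m + 9 := ⟨k - 9, by ring⟩
    have hm : 0 ≤ m := by linarith
    refine mul_nonneg (by linarith) ?_
    nlinarith [mul_nonneg (pow_nonneg hm 3) (sub_nonneg.2 hu.le),
      mul_nonneg (pow_nonneg hm 2) (sub_nonneg.2 hu.le), mul_nonneg hm (sub_nonneg.2 hu.le),
      pow_nonneg hm 3, pow_nonneg hm 2]
  have hpoly : (2 * k + 1) * ((2 * k + 3) * (k - 1)) * (2 * e * (7 * k + 13) - (2 * k + 3)) ≤
      2 * e * ((7 * k + 15) * ((2 * k + 3) * (k - 1)) - 2 * e * (k + 1) ^ 3) *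
        (2 * (k + 2) * e) := by
    obtain ⟨m, rfl⟩ : ∃ m, k = m + 9 := ⟨k - 9, by ring⟩
    have hm : 0 ≤ m := by linarith
    have hU := sub_nonneg.2 hu.le
    have hL := sub_nonneg.2 hl.le
    -- Reducing powers of `e` makes `hpoly` linear in `e`; its leading terms cancel exactly, so the
    -- decimal bounds matter only in lower degrees.
    have g (i : ℕ) : m ^ i * e ^ 2 = m ^ i * (6 * e - 1) := by rw [he]
    have g3 (i : ℕ) : m ^ i * e ^ 3 = m ^ i * (35 * e - 6) := by rw [he3]
    linarith [g 0, g 1, g 2, g 3, g 4, g3 0, g3 1, g3 2, g3 3, g3 4,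
      mul_nonneg (pow_nonneg hm 4) hU, mul_nonneg (pow_nonneg hm 4) hL,
      mul_nonneg (pow_nonneg hm 3) hU, mul_nonneg (pow_nonneg hm 3) hL,
      mul_nonneg (pow_nonneg hm 2) hU, mul_nonneg (pow_nonneg hm 2) hL,
      mul_nonneg hm hU, mul_nonneg hm hL,
      pow_nonneg hm 4, pow_nonneg hm 3, pow_nonneg hm 2]
  have a1 := mul_le_mul_of_nonneg_left hx (show 0 ≤ 2 * e * (k + 1) * (2 * k + 1) from
    mul_nonneg (mul_nonneg (by linarith) (by linarith)) (by linarith))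
  have a2 := mul_le_mul_of_nonneg_left hy hK
  have a3 := mul_le_mul_of_nonneg_right hpoly hz.le
  refine le_of_mul_le_mul_left (a := (2 * k + 1) * ((2 * k + 3) * (k - 1))) ?_
    (mul_pos (by linarith) hQ)
  have a4 : 2 * (k + 3) * e * w =
      2 * e * ((7 * k + 13) * z - (7 * k + 15) * y + (k + 1) * x) := by
    rw [← hrec]; ring
  rw [a4]
  linarith

/-- Same elimination with the two bounds exchanged: upper at `n`, lower at `n + 1`. -/
lemma ratio_lower_step {k e x y z w : ℝ} (hk : 9 ≤ k) (he : e ^ 2 = 6 * e - 1)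
    (hl : 0.171572 < e) (hu : e < 0.171574)
    (hz : 0 < z)
    (hrec : (k + 3) * w = (7 * k + 13) * z - (7 * k + 15) * y + (k + 1) * x)
    (hx : 2 * (k + 1) * e * y ≤ (2 * k - 1) * x)
    (hy : (2 * k + 5) * k * y ≤ 2 * (k + 2) ^ 2 * e * z) :
    (2 * k + 7) * (k + 1) * z ≤ 2 * (k + 3) ^ 2 * e * w := by
  have he3 : e ^ 3 = 35 * e - 6 := by linear_combination (e + 6) * he
  have hM : 0 ≤ (7 * k + 15) * (2 * k - 1) - 2 * (k + 1) ^ 2 * e := by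
    obtain ⟨m, rfl⟩ : ∃ m, k = m + 9 := ⟨k - 9, by ring⟩
    have hm : 0 ≤ m := by linarith
    nlinarith [mul_nonneg (pow_nonneg hm 2) (sub_nonneg.2 hu.le),
      mul_nonneg hm (sub_nonneg.2 hu.le), pow_nonneg hm 2]
  have hpoly : (2 * k - 1) * ((2 * k + 5) * k) * ((2 * k + 7) * (k + 1)) ≤
      2 * (k + 3) * e * ((7 * k + 13) * (2 * k - 1) * ((2 * k + 5) * k) -
        ((7 * k + 15) * (2 * k - 1) - 2 * (k + 1) ^ 2 * e) * (2 * (k + 2) ^ 2 * e)) := by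
    obtain ⟨m, rfl⟩ : ∃ m, k = m + 9 := ⟨k - 9, by ring⟩
    have hm : 0 ≤ m := by linarith
    have hU := sub_nonneg.2 hu.le
    have hL := sub_nonneg.2 hl.le
    have g (i : ℕ) : m ^ i * e ^ 2 = m ^ i * (6 * e - 1) := by rw [he]
    have g3 (i : ℕ) : m ^ i * e ^ 3 = m ^ i * (35 * e - 6) := by rw [he3]
    linarith [g 0, g 1, g 2, g 3, g 4, g 5, g3 0, g3 1, g3 2, g3 3, g3 4, g3 5,
      mul_nonneg (pow_nonneg hm 5) hU, mul_nonneg (pow_nonneg hm 5) hL,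
      mul_nonneg (pow_nonneg hm 4) hU, mul_nonneg (pow_nonneg hm 4) hL,
      mul_nonneg (pow_nonneg hm 3) hU, mul_nonneg (pow_nonneg hm 3) hL,
      mul_nonneg (pow_nonneg hm 2) hU, mul_nonneg (pow_nonneg hm 2) hL,
      mul_nonneg hm hU, mul_nonneg hm hL, pow_nonneg hm 5,
      pow_nonneg hm 4, pow_nonneg hm 3, pow_nonneg hm 2]
  have hk5 : 0 < (2 * k + 5) * k := mul_pos (by linarith) (by linarith)
  have hke : 0 ≤ 2 * (k + 3) * e := mul_nonneg (by linarith) (by linarith)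
  have a1 := mul_le_mul_of_nonneg_left hx (show 0 ≤ 2 * (k + 3) * e * ((k + 1) *
    ((2 * k + 5) * k)) from mul_nonneg hke (mul_nonneg (by linarith) hk5.le))
  have a2 := mul_le_mul_of_nonneg_left hy (mul_nonneg hke hM)
  have a3 := mul_le_mul_of_nonneg_right hpoly hz.le
  refine le_of_mul_le_mul_left (a := (2 * k - 1) * ((2 * k + 5) * k)) ?_
    (mul_pos (by linarith) hk5)
  have a4 : 2 * (k + 3) ^ 2 * e * w =
      2 * (k + 3) * e * ((7 * k + 13) * z - (7 * k + 15) * y + (k + 1) * x) := by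
    rw [← hrec]; ring
  rw [a4]
  linarith

lemma seqBRatioBounds_nine : SeqBRatioBounds 9 := by
  have h1 := lt_growthInv
  have h2 := growthInv_lt
  constructor <;> norm_num [seqB_nine, seqB_ten] <;> linarith

lemma seqBRatioBounds_ten : SeqBRatioBounds 10 := by
  have h1 := lt_growthInv
  have h2 := growthInv_lt
  constructor <;> norm_num [seqB_eleven, seqB_ten] <;> linarith

lemma SeqBRatioBounds.add_two {n : ℕ} (hn : 9 ≤ n) (h0 : SeqBRatioBounds n)
    (h1 : SeqBRatioBounds (n + 1)) : SeqBRatioBounds (n + 2) := by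
  have hn' : (9 : ℝ) ≤ n := by exact_mod_cast hn
  have hl := lt_growthInv
  have hu := growthInv_lt
  obtain ⟨p0, u0, l0⟩ := h0
  obtain ⟨p1, u1, l1⟩ := h1
  push_cast at u1 l1
  have hz : 0 < seqB (n + 2) := by
    have : 0 < (2 * ((n : ℝ) + 1) + 3) * (n + 1 - 1) * seqB (n + 1) := by
      apply mul_pos _ p1
      exact mul_pos (by linarith) (by linarith)
    exact pos_of_mul_pos_right (this.trans_le l1)
      (mul_nonneg (by positivity) (by linarith))
  refine ⟨hz, ?_, ?_⟩
  · have := ratio_upper_step hn' growthInv_sq hl hu hz (seqB_recurrence n) l0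
      (by linarith)
    push_cast
    linarith
  · have := ratio_lower_step hn' growthInv_sq hl hu hz (seqB_recurrence n) u0
      (by linarith)
    push_cast
    linarith

lemma seqBRatioBounds {n : ℕ} (hn : 9 ≤ n) : SeqBRatioBounds n := by
  have key : SeqBRatioBounds n ∧ SeqBRatioBounds (n + 1) := by
    induction n, hn using Nat.le_induction with
    | base => exact ⟨seqBRatioBounds_nine, seqBRatioBounds_ten⟩
    | succ n hn ih => exact ⟨ih.2, ih.1.add_two hn ih.2⟩
  exact key.1

/-! ### Turán-type bounds and the final inequality. -/

/-- `seqB` is log-convex from index `9` on. -/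
lemma sq_seqB_le {n : ℕ} (hn : 9 ≤ n) : seqB (n + 1) ^ 2 ≤ seqB n * seqB (n + 2) := by
  have hn' : (9 : ℝ) ≤ n := by exact_mod_cast hn
  have he : 0 < growthInv := by linarith [lt_growthInv]
  obtain ⟨p0, u0, -⟩ := seqBRatioBounds hn
  obtain ⟨p1, -, l1⟩ := seqBRatioBounds (show 9 ≤ n + 1 by omega)
  push_cast at l1
  have h := mul_le_mul u0 l1
    (mul_nonneg (mul_nonneg (by linarith) (by linarith)) p1.le)
    (mul_nonneg (by linarith) p0.le)
  have hc : 0 < (2 * (n : ℝ) - 1) * (2 * (n + 2) ^ 2 * growthInv) :=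
    mul_pos (by linarith) (by positivity)
  refine le_of_mul_le_mul_left (a := (2 * (n : ℝ) - 1) * (2 * (n + 2) ^ 2 * growthInv)) ?_ hc
  -- The slack is `(2n+5) n (n+1) - (2n-1) (n+2)² = n + 4`.
  have hs : 0 ≤ growthInv * seqB (n + 1) ^ 2 * (n + 4) := by positivity
  rw [show n + 1 + 1 = n + 2 from rfl] at h
  linarith

/-- After division by factorials, which contributes `(n+1)/(n+2)`, the constant becomes
`(n+6)/(n+7)`, as `higherOrderTuran_of_bounds` needs. -/
lemma seqB_mul_le {n : ℕ} (hn : 9 ≤ n) :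
    (n + 1) * (n + 7) * (seqB n * seqB (n + 2)) ≤ (n + 2) * (n + 6) * seqB (n + 1) ^ 2 := by
  have hn' : (9 : ℝ) ≤ n := by exact_mod_cast hn
  have he : 0 < growthInv := by linarith [lt_growthInv]
  obtain ⟨p0, -, l0⟩ := seqBRatioBounds hn
  obtain ⟨p1, u1, -⟩ := seqBRatioBounds (show 9 ≤ n + 1 by omega)
  have p2 := (seqBRatioBounds (show 9 ≤ n + 2 by omega)).pos
  push_cast at u1
  rw [show n + 1 + 1 = n + 2 from rfl] at u1
  have h := mul_le_mul l0 u1 (by positivity) (by positivity)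
  have h' : (2 * (n : ℝ) + 3) * (n - 1) * (n + 2) * (seqB n * seqB (n + 2)) ≤
      (n + 1) ^ 2 * (2 * n + 1) * seqB (n + 1) ^ 2 := by
    refine le_of_mul_le_mul_left (a := 2 * growthInv) ?_ (by positivity)
    linarith
  have hc : 0 < (2 * (n : ℝ) + 3) * (n - 1) * (n + 2) :=
    mul_pos (mul_pos (by linarith) (by linarith)) (by linarith)
  have hpoly : ((n : ℝ) + 1) * (n + 7) * ((n + 1) ^ 2 * (2 * n + 1)) ≤
      (n + 2) * (n + 6) * ((2 * n + 3) * (n - 1) * (n + 2)) := by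
    obtain ⟨m, hm⟩ : ∃ m : ℝ, (n : ℝ) = m + 9 := ⟨n - 9, by ring⟩
    have hm0 : 0 ≤ m := by linarith
    rw [hm]
    linarith [pow_nonneg hm0 4, pow_nonneg hm0 3, pow_nonneg hm0 2]
  have h1 := mul_le_mul_of_nonneg_left h' (show 0 ≤ ((n : ℝ) + 1) * (n + 7) by positivity)
  have h2 := mul_le_mul_of_nonneg_right hpoly (sq_nonneg (seqB (n + 1)))
  refine le_of_mul_le_mul_left (a := (2 * (n : ℝ) + 3) * (n - 1) * (n + 2)) ?_ hc
  linarith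

/-- If the reciprocals of the relative Turán defects of four consecutive terms lie in
`[t + 1, t + 6]` and `[t + 2, t + 7]`, the higher order Turán inequality holds. -/
lemma higherOrderTuran_of_bounds {t x y z w : ℝ} (ht : 8 ≤ t) (hy : 0 < y) (hz : 0 < z)
    (h1 : t * y ^ 2 ≤ (t + 1) * (x * z)) (h2 : (t + 6) * (x * z) ≤ (t + 5) * y ^ 2)
    (h3 : (t + 1) * z ^ 2 ≤ (t + 2) * (y * w)) (h4 : (t + 7) * (y * w) ≤ (t + 6) * z ^ 2) :
    4 * (y ^ 2 - x * z) * (z ^ 2 - y * w) - (y * z - x * w) ^ 2 ≥ 0 := by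
  have hy2 : 0 < y ^ 2 := by positivity
  have hz2 : 0 < z ^ 2 := by positivity
  have hP : 0 < y ^ 2 - x * z := by
    refine pos_of_mul_pos_right (a := t + 6) ?_ (by linarith)
    linarith
  have hR : 0 < z ^ 2 - y * w := by
    refine pos_of_mul_pos_right (a := t + 7) ?_ (by linarith)
    linarith
  obtain ⟨s, hs⟩ : ∃ s, s = y ^ 2 / (y ^ 2 - x * z) := ⟨_, rfl⟩
  obtain ⟨r, hr⟩ : ∃ r, r = z ^ 2 / (z ^ 2 - y * w) := ⟨_, rfl⟩
  have s1 : t + 1 ≤ s := by rw [hs, le_div_iff₀ hP]; linarith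
  have s2 : s ≤ t + 6 := by rw [hs, div_le_iff₀ hP]; linarith
  have r1 : t + 2 ≤ r := by rw [hr, le_div_iff₀ hR]; linarith
  have r2 : r ≤ t + 7 := by rw [hr, div_le_iff₀ hR]; linarith
  rw [eq_div_iff hP.ne'] at hs
  rw [eq_div_iff hR.ne'] at hr
  have hs0 : 0 < s := by linarith
  have hr0 : 0 < r := by linarith
  have hx : x = y ^ 2 * (s - 1) / (s * z) := by
    rw [eq_div_iff (by positivity)]; linear_combination -hs
  have hw : w = z ^ 2 * (r - 1) / (r * y) := by
    rw [eq_div_iff (by positivity)]; linear_combination -hr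
  have key : 4 * (y ^ 2 - x * z) * (z ^ 2 - y * w) - (y * z - x * w) ^ 2 =
      (y * z / (s * r)) ^ 2 * (4 * s * r - (s + r - 1) ^ 2) := by
    rw [hx, hw]
    field_simp
    ring
  rw [key]
  refine mul_nonneg (sq_nonneg _) ?_
  -- `4sr - (s+r-1)² = 2(s+r) - 1 - (s-r)² ≥ 2(2t+3) - 1 - 36`, which is positive for `t ≥ 8`.
  nlinarith [mul_nonneg (show 0 ≤ s - r + 6 by linarith) (show 0 ≤ r - s + 6 by linarith)]

theorem mainTheorem5 :
    HigherOrderTuran (fun n : ℕ => seqB n / (n.factorial : ℝ)) := by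
  intro n hn
  rcases Nat.lt_or_ge n 10 with h | h
  -- The lower ratio bound fails at index 8, so small cases are checked by value.
  · interval_cases n <;>
    norm_num [seqB_zero, seqB_one, seqB_two, seqB_three, seqB_four, seqB_five, seqB_six,
      seqB_seven, seqB_eight, seqB_nine, seqB_ten, seqB_eleven, Nat.factorial]
  obtain ⟨m, rfl⟩ : ∃ m, n = m + 1 := ⟨n - 1, by omega⟩
  have hm : 9 ≤ m := by omega
  have hm' : (9 : ℝ) ≤ m := by exact_mod_cast hm
  have p1 := (seqBRatioBounds (show 9 ≤ m + 1 by omega)).pos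
  have p2 := (seqBRatioBounds (show 9 ≤ m + 2 by omega)).pos
  have c0 := sq_seqB_le hm
  have c1 := sq_seqB_le (show 9 ≤ m + 1 by omega)
  have d0 := seqB_mul_le hm
  have d1 := seqB_mul_le (show 9 ≤ m + 1 by omega)
  simp only [Nat.add_sub_cancel, Nat.factorial_succ, show m + 1 + 1 = m + 2 from rfl,
    show m + 1 + 2 = m + 3 from rfl] at c1 d1 ⊢
  push_cast at d1 ⊢
  have hf : (0 : ℝ) < m.factorial := by positivity
  apply higherOrderTuran_of_bounds (t := (m : ℝ) + 1) (by linarith) (by positivity)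
    (by positivity)
  · field_simp
    linarith [mul_le_mul_of_nonneg_left c0 (show 0 ≤ (m : ℝ) + 2 by positivity)]
  · field_simp
    linarith
  · field_simp
    linarith [mul_le_mul_of_nonneg_left c1 (show 0 ≤ ((m : ℝ) + 2) * (m + 3) by positivity)]
  · field_simp
    linarith
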